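/- Consider the $K$-user interference channel with $M\ge 1$ antennas at every node, in which receiver $j$ hears its own transmitter $j$ and exactly $N$ interfering transmitters, namely the $\lceil N/2\rceil$ preceding and the $\lfloor N/2\rfloor$ following ones in cyclic order, where $3\le N\le K-1$; write $I_j$ for the set of interferers of receiver $j$. Signals are encoded over $n\ge 1$ slots. All channel coefficients (over all links, antenna pairs and slots) are drawn i.i.d. from a probability distribution on $\mathbb C$ without atoms. Let $\bar H^{[j,i]}$ be the $Mn\times Mn$ block diagonal matrix whose $n$ diagonal blocks are the $M\times M$ channel matrices from transmitter $i$ to receiver $j$ in the $n$ slots (it is zero if $i\ne j$ and $i\notin I_j$). Then, for every such $K,N,M,n$, with probability $1$ the following hold. 1. There are no beamforming matrices $V^{[1]},\dots,V^{[K]}$ of size $Mn\times \frac{Mn}{2}$ (with $Mn$ even) and full column rank that satisfy the interference alignment conditions: for every receiver $j$, the matrices $\bar H^{[j,i]}V^{[i]}$, $i\in I_j$, all have the same column space, and the column space of $\bar H^{[j,j]}V^{[j]}$ intersects the span of these interference spaces only in $0$. 2. If $n$ is odd, there are no $Mn\times\frac{Mn}{2}$ matrices $V^{[1]},\dots,V^{[K]}$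 of full column rank that satisfy even the first half of these conditions, that is, for which for every $j$ all $\bar H^{[j,i]}V^{[i]}$, $i\in I_j$, have the same column space. 3. The multiplexing gain $\frac{KM}{2}$ is not attained by linear beamforming over the $n$ slots: for all numbers of streams $d_1,\dots,d_K$ and all $Mn\times d_k$ beamforming matrices $V^{[k]}$, the sum rate per slot $$R(\rho)=\frac1n\sum_{j=1}^K\Bigl[\log\det\Bigl(I+\rho\sum_{i=1}^K G_{ji}G_{ji}^{*}\Bigr)-\log\det\Bigl(I+\rho\sum_{i\ne j}G_{ji}G_{ji}^{*}\Bigr)\Bigr],\qquad G_{ji}=\bar H^{[j,i]}V^{[i]},$$ of Gaussian streams with unit-variance noise and interference treated as noise satisfies $\lim_{\rho\to\infty} R(\rho)/\log\rho=\Gamma$ for some $\Gamma<\frac{KM}{2}$. -/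

import Mathlib

open MeasureTheory Filter Topology

noncomputable section

namespace PartialIC

/-- In the cyclic network with `K` users, transmitter `i` is one of the interferers of receiver `j`:
it is among the `⌈N/2⌉` transmitters preceding `j` or the `⌊N/2⌋` transmitters following `j`. -/
def Interferes (K N : ℕ) (j i : Fin K) : Prop :=
  (∃ m : ℕ, 1 ≤ m ∧ m ≤ (N + 1) / 2 ∧ ((i : ℕ) + m) % K = (j : ℕ)) ∨
    (∃ m : ℕ, 1 ≤ m ∧ m ≤ N / 2 ∧ ((j : ℕ) + m) % K = (i : ℕ))

/-- A draw of all channel coefficients: `h (j, i, l, r, t)` is the coefficient from antenna `t` of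
transmitter `i` to antenna `r` of receiver `j` in slot `l`. -/
abbrev Draw (K M n : ℕ) : Type := Fin K × Fin K × Fin n × Fin M × Fin M → ℂ

/-- The law of the draw when all coefficients are i.i.d. with law `μ`. -/
def drawLaw (K M n : ℕ) (μ : Measure ℂ) : Measure (Draw K M n) :=
  Measure.pi fun _ => μ

open scoped Classical in
/-- The channel matrix from transmitter `i` to receiver `j` over all `n` slots: block diagonal, with
one `M × M` block for each slot, and zero if there is no link from `i` to `j`. -/
def channel {K M n : ℕ} (N : ℕ) (h : Draw K M n) (j i : Fin K) :
    Matrix (Fin M × Fin n) (Fin M × Fin n) ℂ :=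
  if i = j ∨ Interferes K N j i then
    Matrix.blockDiagonal fun l : Fin n => Matrix.of fun r t : Fin M => h (j, i, l, r, t)
  else 0

/-- The column space of a matrix. -/
def colSpace {m p : Type*} [Fintype p] (A : Matrix m p ℂ) : Submodule ℂ (m → ℂ) :=
  LinearMap.range A.mulVecLin

/-- The alignment conditions: at each receiver, the signals from all its interferers have the same
column space. -/
def Aligned {K M n : ℕ} (N : ℕ) (h : Draw K M n) {d : ℕ}
    (V : Fin K → Matrix (Fin M × Fin n) (Fin d) ℂ) : Prop :=
  ∀ j i i' : Fin K, Interferes K N j i → Interferes K N j i' →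
    colSpace (channel N h j i * V i) = colSpace (channel N h j i' * V i')

/-- At each receiver, the space of the desired signal meets the space spanned by all the
interference only in zero. -/
def Separated {K M n : ℕ} (N : ℕ) (h : Draw K M n) {d : ℕ}
    (V : Fin K → Matrix (Fin M × Fin n) (Fin d) ℂ) : Prop :=
  ∀ j : Fin K, Disjoint (colSpace (channel N h j j * V j))
    (⨆ (i : Fin K) (_ : Interferes K N j i), colSpace (channel N h j i * V i))

/-- Covariance at receiver `j` of the signal from transmitter `i`, whose input is `V i * x` with
independent standard complex Gaussian streams `x`. -/
def signalCov {K M n : ℕ} (N : ℕ) (h : Draw K M n) {d : Fin K → ℕ}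
    (V : (k : Fin K) → Matrix (Fin M × Fin n) (Fin (d k)) ℂ) (j i : Fin K) :
    Matrix (Fin M × Fin n) (Fin M × Fin n) ℂ :=
  (channel N h j i * V i) * (channel N h j i * V i).conjTranspose

/-- Sum rate per slot at signal-to-noise ratio `ρ` of linear beamforming with the matrices `V k`,
Gaussian streams, and unit-variance complex Gaussian noise, each receiver treating
the interference as noise: the rate of user `j` over the `n` slots is the mutual information
`log det (1 + ρ (S + Q)) - log det (1 + ρ Q)`, where `S` and `Q` are the covariances of the
desired signal and of the interference. -/
def sumRate {K M n : ℕ} (N : ℕ) (h : Draw K M n) {d : Fin K → ℕ}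
    (V : (k : Fin K) → Matrix (Fin M × Fin n) (Fin (d k)) ℂ) (ρ : ℝ) : ℝ :=
  (∑ j : Fin K,
    (Real.log (1 + (ρ : ℂ) • ∑ i : Fin K, signalCov N h V j i).det.re
      - Real.log (1 + (ρ : ℂ) • ∑ i ∈ Finset.univ.erase j, signalCov N h V j i).det.re)) / (n : ℝ)

/-- Linear beamforming with the matrices `V k` attains exactly the multiplexing gain `Γ`: the ratio
of the sum rate per slot to `log ρ` tends to `Γ` as `ρ → ∞`. -/
def HasMultiplexingGain {K M n : ℕ} (N : ℕ) (h : Draw K M n) {d : Fin K → ℕ}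
    (V : (k : Fin K) → Matrix (Fin M × Fin n) (Fin (d k)) ℂ) (Γ : ℝ) : Prop :=
  Tendsto (fun ρ : ℝ => sumRate N h V ρ / Real.log ρ) atTop (𝓝 Γ)

end PartialIC

end

/-!
Call the column space of `V i` the signal space `W i`. All channel matrices are block diagonal over
the slots, and almost surely invertible. If interference is aligned at a receiver, the two channel
matrices from transmitters `i` and `j` to it give a block diagonal matrix taking `W i` to `W j`
(`transfer`). Since every receiver `k` hears `k - 2`, `k - 1` and `k + 1`, these transfers close up
to loops, and two of the loops through user `0` each contain a channel matrix that occurs nowhere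
else (`innerLoop`, `outerLoop`). So `W 0` is invariant under two block diagonal matrices in general
position, and such a pair generates the algebra of all block diagonal matrices. In detail, certain
words in the two loops have entries that are polynomials in the channel coefficients, and for one
special draw the words are the matrix units; hence the determinant of `wordEntries` expressing their
linear independence is not the zero polynomial, and it is almost surely nonzero because the zero set
of a polynomial is null for a product of atomless laws (`ae_eval_ne_zero`, `ae_generic`).

A subspace invariant under all block diagonal matrices consists of all vectors supported on a set
of slots. Its dimension is a multiple of `M`, say `M * s`, and `2 * M * s = M * n` is impossible for
odd `n` (`not_aligned_of_odd`). Moreover `W 1` is supported on the same slots as `W 0`, so that the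
desired signal at receiver `1` lies in the interference (`LoopAligned.map_le_map`), which
contradicts separation.

For the multiplexing gain, `log det (1 + ρ Q)` grows like `rank Q * log ρ`
(`tendsto_log_det_div_log`), so that the gain is `1 / n` times the sum over the receivers of the
number of dimensions of the received space in excess of the interference space. Interference at a
receiver takes up at least the dimension of each interferer's signal space, so that the numbers of
two users at distance one or two sum to at most `M * n`. Were the gain at least `K * M / 2`, all
these inequalities would be equalities (`eq_half_of_le_sum`), all spaces would have dimension
`M * n / 2`, and the signal spaces would be aligned and separated, which has been excluded.
-/

namespace PartialIC

/-! ### Zero sets of polynomials under products of atomless measures -/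

/-- Induction on the number of variables: where the leading coefficient in the first variable does
not vanish, only finitely many values of that variable are roots. -/
theorem ae_eval_ne_zero_fin (μ : Measure ℂ) [IsProbabilityMeasure μ] [NullSingletonClass μ] :
    ∀ (s : ℕ) (p : MvPolynomial (Fin s) ℂ), p ≠ 0 →
      ∀ᵐ x ∂(Measure.pi fun _ : Fin s => μ), MvPolynomial.eval x p ≠ 0 := by
  intro s
  induction s with
  | zero =>
    intro p hp
    obtain ⟨c, rfl⟩ := MvPolynomial.C_surjective (Fin 0) p
    refine Eventually.of_forall fun x => ?_
    rw [MvPolynomial.eval_C]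
    rintro rfl
    exact hp (map_zero _)
  | succ s ih =>
    intro p hp
    set P := MvPolynomial.finSuccEquiv ℂ s p with hP
    have hP0 : P ≠ 0 := by
      rw [hP]
      exact (map_ne_zero_iff _ (MvPolynomial.finSuccEquiv ℂ s).injective).2 hp
    have hlead := ih P.leadingCoeff (Polynomial.leadingCoeff_ne_zero.2 hP0)
    have hmp := measurePreserving_piFinSuccAbove (fun _ : Fin (s + 1) => μ) 0
    have hmeas : MeasurableSet {x : Fin (s + 1) → ℂ | MvPolynomial.eval x p ≠ 0} :=
      ((isClosed_singleton (x := (0 : ℂ))).preimage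
        (MvPolynomial.continuous_eval p)).measurableSet.compl
    have key : ∀ᵐ z ∂((Measure.pi fun _ : Fin s => μ).prod μ),
        MvPolynomial.eval (Fin.cons z.2 z.1 : Fin (s + 1) → ℂ) p ≠ 0 := by
      have hc : Continuous fun z : (Fin s → ℂ) × ℂ => (Fin.cons z.2 z.1 : Fin (s + 1) → ℂ) := by
        refine continuous_pi fun i => ?_
        refine Fin.cases ?_ (fun i => ?_) i
        · simpa using continuous_snd
        · simpa [Function.comp_def] using (continuous_apply i).comp continuous_fst
      refine (Measure.ae_prod_iff_ae_ae (hc.measurable hmeas)).2 ?_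
      filter_upwards [hlead] with y hy
      have hQ : P.map (MvPolynomial.eval y) ≠ 0 := fun h0 => hy <| by
        simpa using congrArg (fun q => q.coeff P.natDegree) h0
      have hfin : ({x | (P.map (MvPolynomial.eval y)).IsRoot x} : Set ℂ).Finite :=
        Polynomial.finite_setOfPred_isRoot hQ
      refine (measure_eq_zero_iff_ae_notMem.1 (hfin.measure_zero μ)).mono fun x hx => ?_
      rw [MvPolynomial.eval_eq_eval_mv_eval']
      exact hx
    have hswap := (Measure.measurePreserving_swap (μ := μ)
      (ν := Measure.pi fun _ : Fin s => μ)).comp hmp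
    refine (hswap.quasiMeasurePreserving.ae key).mono fun x hx => ?_
    simpa [MeasurableEquiv.piFinSuccAbove, Fin.insertNthEquiv, Fin.removeNth,
      Fin.cons_self_tail] using hx

/-- A nonzero polynomial vanishes on a null set of any finite power of an atomless law. -/
theorem ae_eval_ne_zero {σ : Type*} [Fintype σ] (μ : Measure ℂ) [IsProbabilityMeasure μ]
    [NullSingletonClass μ] {p : MvPolynomial σ ℂ} (hp : p ≠ 0) :
    ∀ᵐ x ∂(Measure.pi fun _ : σ => μ), MvPolynomial.eval x p ≠ 0 := by
  let e := (Fintype.equivFin σ).symm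
  have hq : MvPolynomial.rename e.symm p ≠ 0 :=
    (map_ne_zero_iff _ (MvPolynomial.rename_injective _ e.symm.injective)).2 hp
  have hmp := (measurePreserving_piCongrLeft (fun _ : σ => μ) e).symm
  refine (hmp.quasiMeasurePreserving.ae (ae_eval_ne_zero_fin μ _ _ hq)).mono fun x hx => ?_
  rw [MvPolynomial.eval_rename] at hx
  convert hx using 2
  congr 1
  funext i
  simp [MeasurableEquiv.piCongrLeft, Equiv.piCongrLeft, Equiv.piCongrLeft']

/-! ### The rate of growth of `log det` -/

theorem tendsto_log_one_add_mul_div_log {a : ℝ} (ha : 0 ≤ a) :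
    Tendsto (fun ρ : ℝ => Real.log (1 + ρ * a) / Real.log ρ) atTop
      (𝓝 (if a ≠ 0 then 1 else 0)) := by
  rcases ha.eq_or_lt with rfl | ha
  · simp
  · rw [if_pos ha.ne']
    -- `log (1 + ρ a) = log ρ + log (a + ρ⁻¹)`, where the second summand stays bounded
    have h1 : Tendsto (fun ρ : ℝ => Real.log (a + ρ⁻¹)) atTop (𝓝 (Real.log a)) := by
      have : Tendsto (fun ρ : ℝ => a + ρ⁻¹) atTop (𝓝 a) := by
        simpa using (tendsto_inv_atTop_zero (𝕜 := ℝ)).const_add a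
      exact this.log ha.ne'
    have h2 := (h1.div_atTop Real.tendsto_log_atTop).const_add 1
    rw [add_zero] at h2
    refine h2.congr' ?_
    filter_upwards [eventually_gt_atTop 1] with ρ hρ
    have hρ0 : 0 < ρ := by linarith
    have hl : Real.log ρ ≠ 0 := (Real.log_pos hρ).ne'
    have : 1 + ρ * a = ρ * (a + ρ⁻¹) := by field_simp; ring
    rw [this, Real.log_mul hρ0.ne' (by positivity)]
    field_simp

open Matrix in
theorem det_one_add_smul {m : Type*} [Fintype m] [DecidableEq m] {Q : Matrix m m ℂ}
    (hQ : Q.IsHermitian) (ρ : ℝ) :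
    (1 + (ρ : ℂ) • Q).det = ((∏ i, (1 + ρ * hQ.eigenvalues i) : ℝ) : ℂ) := by
  have h : 1 + (ρ : ℂ) • Q = Unitary.conjStarAlgAut ℂ _ hQ.eigenvectorUnitary
      (1 + (ρ : ℂ) • diagonal (RCLike.ofReal ∘ hQ.eigenvalues)) := by
    rw [map_add, map_one, map_smul, ← hQ.spectral_theorem]
  rw [h, Unitary.conjStarAlgAut_apply, det_mul_comm, ← mul_assoc]
  simp only [Unitary.coe_star_mul_self, one_mul]
  rw [← diagonal_one, ← diagonal_smul, diagonal_add, det_diagonal]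
  simp

open scoped ComplexOrder in
/-- `log det (1 + ρ Q)` grows like `rank Q * log ρ`: each positive eigenvalue contributes
one `log ρ`. -/
theorem tendsto_log_det_div_log {m : Type*} [Fintype m] [DecidableEq m] {Q : Matrix m m ℂ}
    (hQ : Q.PosSemidef) :
    Tendsto (fun ρ : ℝ => Real.log (1 + (ρ : ℂ) • Q).det.re / Real.log ρ) atTop
      (𝓝 (Q.rank : ℝ)) := by
  have hsum := tendsto_finsetSum Finset.univ fun i (_ : i ∈ Finset.univ) =>
    tendsto_log_one_add_mul_div_log (hQ.eigenvalues_nonneg i)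
  have hrank : (∑ i, if hQ.1.eigenvalues i ≠ 0 then (1 : ℝ) else 0) = Q.rank := by
    rw [hQ.1.rank_eq_card_non_zero_eigs, Fintype.card_subtype, Finset.sum_boole]
  rw [hrank] at hsum
  refine hsum.congr' ?_
  filter_upwards [eventually_ge_atTop 0] with ρ hρ
  rw [det_one_add_smul hQ.1, Complex.ofReal_re, Real.log_prod, Finset.sum_div]
  intro i _
  have := mul_nonneg hρ (hQ.eigenvalues_nonneg i)
  positivity

open scoped ComplexOrder in
/-- The rank of a sum of covariances is the dimension of the span of the signal spaces: the sum is
`B * Bᴴ` for the matrix `B` that has all the given matrices side by side. -/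
theorem rank_sum_mul_conjTranspose {ι m : Type*} [Fintype m] [DecidableEq ι] {d : ι → ℕ}
    (s : Finset ι) (G : (i : ι) → Matrix m (Fin (d i)) ℂ) :
    (∑ i ∈ s, G i * (G i).conjTranspose).rank = Module.finrank ℂ (⨆ i ∈ s, colSpace (G i) :
      Submodule ℂ (m → ℂ)) := by
  let B : Matrix m (Σ i : s, Fin (d i)) ℂ := Matrix.of fun r c => G c.1 r c.2
  have hB : ∑ i ∈ s, G i * (G i).conjTranspose = B * B.conjTranspose := by
    ext r t
    rw [Matrix.sum_apply, ← Finset.sum_coe_sort s, Matrix.mul_apply, Fintype.sum_sigma]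
    rfl
  rw [hB, Matrix.rank_self_mul_conjTranspose, Matrix.rank]
  suffices h : LinearMap.range B.mulVecLin = ⨆ i ∈ s, colSpace (G i) by rw [h]
  simp only [colSpace, Matrix.range_mulVecLin]
  rw [← Submodule.span_iUnion₂]
  congr 1
  ext v
  simp only [Set.mem_range, Set.mem_iUnion]
  constructor
  · rintro ⟨⟨i, c⟩, rfl⟩
    exact ⟨i, i.2, c, rfl⟩
  · rintro ⟨i, hi, c, rfl⟩
    exact ⟨⟨⟨i, hi⟩, c⟩, rfl⟩

variable {K M n : ℕ}

/-! ### Block diagonal links and the loops they form -/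

/-- The block diagonal channel matrix from transmitter `i` to receiver `j` with coefficients in a
ring `A`, defined also for pairs without a link. Taking `A` to be a polynomial ring gives the
channel with indeterminate coefficients. -/
def link {A : Type*} [Zero A] (x : Fin K × Fin K × Fin n × Fin M × Fin M → A) (j i : Fin K) :
    Matrix (Fin M × Fin n) (Fin M × Fin n) A :=
  Matrix.blockDiagonal fun l : Fin n => Matrix.of fun r t : Fin M => x (j, i, l, r, t)

/-- If the signals from `i` and `j` are aligned at receiver `k`, this matrix takes the signal space
of transmitter `i` into that of transmitter `j`. It is `(H k j)⁻¹ * H k i` up to the factor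
`(H k j).det`; the adjugate keeps it polynomial in the coefficients. -/
def transfer {ι A U : Type*} [Fintype ι] [DecidableEq ι] [CommRing A] (H : U → U → Matrix ι ι A)
    (k i j : U) : Matrix ι ι A :=
  (H k j).adjugate * H k i

/-- A loop of transfers from the signal space of `u 0` to itself, containing the link from `u 2`
to `u 1`, which occurs neither elsewhere in it nor in `outerLoop`. -/
def innerLoop {ι A U : Type*} [Fintype ι] [DecidableEq ι] [CommRing A] (H : U → U → Matrix ι ι A)
    (u : Fin 5 → U) : Matrix ι ι A :=
  transfer H (u 1) (u 2) (u 0) * (transfer H (u 3) (u 1) (u 2) * transfer H (u 2) (u 0) (u 1))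

/-- A loop of transfers from the signal space of `u 0` to itself, containing the link from `u 3`
to `u 2`, which occurs neither elsewhere in it nor in `innerLoop`. -/
def outerLoop {ι A U : Type*} [Fintype ι] [DecidableEq ι] [CommRing A] (H : U → U → Matrix ι ι A)
    (u : Fin 5 → U) : Matrix ι ι A :=
  transfer H (u 2) (u 3) (u 0) * (transfer H (u 4) (u 2) (u 3) *
    (transfer H (u 3) (u 1) (u 2) * transfer H (u 2) (u 0) (u 1)))

/-- Distinct complex numbers, one for each antenna and slot. -/
noncomputable def node (a : Fin M × Fin n) : ℂ := ((Fintype.equivFin (Fin M × Fin n) a : ℕ) : ℂ)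

theorem node_injective : Function.Injective (node (M := M) (n := n)) := fun a b h => by
  have := Nat.cast_injective (R := ℂ) h
  exact (Fintype.equivFin _).injective (Fin.ext this)

/-- The Lagrange polynomial that is `1` at the node of `a` and `0` at the other nodes. -/
noncomputable def nodeBasis (a : Fin M × Fin n) : Polynomial ℂ :=
  Lagrange.basis Finset.univ node a

theorem eval_nodeBasis (a b : Fin M × Fin n) :
    (nodeBasis a).eval (node b) = if b = a then 1 else 0 := by
  split_ifs with h
  · subst h
    exact Lagrange.eval_basis_self node_injective.injOn (Finset.mem_univ _)
  · exact Lagrange.eval_basis_of_ne (Ne.symm h) (Finset.mem_univ _)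

/-- An element of the algebra generated by the two loops. For the draw `matrixUnitDraw` it is the
matrix unit at row `r` and column `t` of slot `l`, where `c = (r, t, l)`. -/
noncomputable def loopWord {A U : Type*} [CommRing A] [Algebra ℂ A]
    (H : U → U → Matrix (Fin M × Fin n) (Fin M × Fin n) A)
    (u : Fin 5 → U) (c : Fin M × Fin M × Fin n) : Matrix (Fin M × Fin n) (Fin M × Fin n) A :=
  Polynomial.aeval (innerLoop H u) (nodeBasis (c.1, c.2.2)) * outerLoop H u *
    Polynomial.aeval (innerLoop H u) (nodeBasis (c.2.1, c.2.2))

/-- The entries in the diagonal blocks of all the words `loopWord H u c`, column `c` holding the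
entries of word `c`. -/
noncomputable def wordEntries {A U : Type*} [CommRing A] [Algebra ℂ A]
    (H : U → U → Matrix (Fin M × Fin n) (Fin M × Fin n) A) (u : Fin 5 → U) :
    Matrix (Fin M × Fin M × Fin n) (Fin M × Fin M × Fin n) A :=
  Matrix.of fun c' c => loopWord H u c (c'.1, c'.2.2) (c'.2.1, c'.2.2)

section Naturality

variable {A B : Type*} [CommRing A] [CommRing B] [Algebra ℂ A] [Algebra ℂ B] (f : A →ₐ[ℂ] B)

theorem mapMatrix_link (x : Fin K × Fin K × Fin n × Fin M × Fin M → A) (j i : Fin K) :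
    f.mapMatrix (link x j i) = link (fun c => f (x c)) j i := by
  ext a b
  simp only [link, AlgHom.mapMatrix_apply, Matrix.map_apply, Matrix.blockDiagonal_apply,
    Matrix.of_apply]
  split_ifs <;> simp

variable {ι U : Type*} [Fintype ι] [DecidableEq ι]

theorem mapMatrix_innerLoop (H : U → U → Matrix ι ι A) (u : Fin 5 → U) :
    f.mapMatrix (innerLoop H u) = innerLoop (fun j i => f.mapMatrix (H j i)) u := by
  simp only [innerLoop, transfer, map_mul, AlgHom.map_adjugate]

theorem mapMatrix_outerLoop (H : U → U → Matrix ι ι A) (u : Fin 5 → U) :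
    f.mapMatrix (outerLoop H u) = outerLoop (fun j i => f.mapMatrix (H j i)) u := by
  simp only [outerLoop, transfer, map_mul, AlgHom.map_adjugate]

theorem mapMatrix_wordEntries (H : U → U → Matrix (Fin M × Fin n) (Fin M × Fin n) A)
    (u : Fin 5 → U) :
    f.mapMatrix (wordEntries H u) = wordEntries (fun j i => f.mapMatrix (H j i)) u := by
  have hw : ∀ c, f.mapMatrix (loopWord H u c) =
      loopWord (fun j i => f.mapMatrix (H j i)) u c := fun c => by
    simp only [loopWord, map_mul, mapMatrix_outerLoop, ← Polynomial.aeval_algHom_apply,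
      mapMatrix_innerLoop]
  ext c' c
  simp only [wordEntries, Matrix.of_apply, ← hw]
  rfl

end Naturality

/-! ### Generic channels -/

/-- The draw whose links are the identity, except that the link from `u 2` to `u 1` is diagonal
with the distinct entries `node` and that from `u 3` to `u 2` has only ones in its blocks. -/
noncomputable def matrixUnitDraw (u : Fin 5 → Fin K) : Draw K M n := fun c =>
  if c.1 = u 1 ∧ c.2.1 = u 2 then (if c.2.2.2.1 = c.2.2.2.2 then node (c.2.2.2.1, c.2.2.1) else 0)
  else if c.1 = u 2 ∧ c.2.1 = u 3 then 1
  else if c.2.2.2.1 = c.2.2.2.2 then 1 else 0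

theorem link_matrixUnitDraw_of_ne {u : Fin 5 → Fin K} {j i : Fin K} (h1 : ¬(j = u 1 ∧ i = u 2))
    (h2 : ¬(j = u 2 ∧ i = u 3)) :
    link (matrixUnitDraw u : Draw K M n) j i = 1 := by
  ext ⟨r, l⟩ ⟨t, l'⟩
  simp only [link, matrixUnitDraw, Matrix.blockDiagonal_apply, Matrix.of_apply, h1, h2,
    Matrix.one_apply, Prod.mk.injEq]
  split_ifs <;> simp_all

theorem link_identityDraw (j i : Fin K) :
    link (fun c : Fin K × Fin K × Fin n × Fin M × Fin M =>
      if c.2.2.2.1 = c.2.2.2.2 then (1 : ℂ) else 0) j i = 1 := by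
  ext ⟨r, l⟩ ⟨t, l'⟩
  simp only [link, Matrix.blockDiagonal_apply, Matrix.of_apply, Matrix.one_apply, Prod.mk.injEq]
  split_ifs <;> simp_all

theorem wordEntries_matrixUnitDraw {u : Fin 5 → Fin K} (h02 : u 0 ≠ u 2) (h03 : u 0 ≠ u 3)
    (h12 : u 1 ≠ u 2) (h13 : u 1 ≠ u 3) (h23 : u 2 ≠ u 3) (h41 : u 4 ≠ u 1) (h42 : u 4 ≠ u 2) :
    wordEntries (link (matrixUnitDraw u : Draw K M n)) u = 1 := by
  have l1 := fun j i => link_matrixUnitDraw_of_ne (M := M) (n := n) (u := u) (j := j) (i := i)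
  have hF : innerLoop (link (matrixUnitDraw u : Draw K M n)) u = Matrix.diagonal node := by
    have : link (matrixUnitDraw u : Draw K M n) (u 1) (u 2) = Matrix.diagonal node := by
      ext ⟨r, l⟩ ⟨t, l'⟩
      simp only [link, matrixUnitDraw, Matrix.blockDiagonal_apply, Matrix.of_apply,
        Matrix.diagonal_apply, Prod.mk.injEq]
      split_ifs <;> simp_all
    rw [innerLoop, transfer, transfer, transfer, this, l1 (u 1) (u 0), l1 (u 3) (u 2),
      l1 (u 3) (u 1), l1 (u 2) (u 1), l1 (u 2) (u 0)] <;>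
      simp [*, h12.symm, h13.symm, h23.symm]
  have hG : ∀ r t l, outerLoop (link (matrixUnitDraw u : Draw K M n)) u (r, l) (t, l) = 1 := by
    intro r t l
    have : link (matrixUnitDraw u : Draw K M n) (u 2) (u 3) (r, l) (t, l) = 1 := by
      simp [link, matrixUnitDraw, Matrix.blockDiagonal_apply, h12.symm]
    rw [outerLoop, transfer, transfer, transfer, transfer, l1 (u 2) (u 0), l1 (u 4) (u 3),
      l1 (u 4) (u 2), l1 (u 3) (u 2), l1 (u 3) (u 1), l1 (u 2) (u 1)]
    · simp [this]
    all_goals simp [*, h12.symm, h13.symm, h23.symm]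
  have hP : ∀ a : Fin M × Fin n, Polynomial.aeval (Matrix.diagonal node) (nodeBasis a) =
      Matrix.diagonal fun b => if b = a then (1 : ℂ) else 0 := fun a => by
    have := Polynomial.aeval_algHom_apply (Matrix.diagonalAlgHom ℂ (α := ℂ))
      (node (M := M) (n := n)) (nodeBasis a)
    refine this.trans ?_
    refine congrArg Matrix.diagonal (funext fun b => ?_)
    have h2 := Polynomial.aeval_algHom_apply
      (Pi.evalAlgHom ℂ (fun _ : Fin M × Fin n => ℂ) b) node (nodeBasis a)
    refine h2.symm.trans ?_
    rw [Polynomial.coe_aeval_eq_eval]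
    exact eval_nodeBasis a b
  ext ⟨r', t', l'⟩ ⟨r, t, l⟩
  rw [wordEntries, Matrix.of_apply, loopWord, hF, hP, hP, Matrix.mul_diagonal,
    Matrix.diagonal_mul, hG, Matrix.one_apply]
  simp only [Prod.mk.injEq]
  split_ifs <;> simp_all

/-- Almost surely all the matrices `link h j i` are invertible and the words `loopWord` are
linearly independent: both say that a polynomial in the coefficients does not vanish, and it does
not vanish identically. -/
theorem ae_generic (μ : Measure ℂ) [IsProbabilityMeasure μ] [NullSingletonClass μ]
    {u : Fin 5 → Fin K} (h02 : u 0 ≠ u 2) (h03 : u 0 ≠ u 3)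
    (h12 : u 1 ≠ u 2) (h13 : u 1 ≠ u 3) (h23 : u 2 ≠ u 3) (h41 : u 4 ≠ u 1) (h42 : u 4 ≠ u 2) :
    ∀ᵐ h ∂(drawLaw K M n μ),
      (∀ j i, (link h j i).det ≠ 0) ∧ (wordEntries (link h) u).det ≠ 0 := by
  let X := fun c : Fin K × Fin K × Fin n × Fin M × Fin M => (MvPolynomial.X c : MvPolynomial _ ℂ)
  have hlink : ∀ (h : Draw K M n) j i,
      (MvPolynomial.aeval h).mapMatrix (link X j i) = link h j i := fun h j i => by
    rw [mapMatrix_link]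
    simp [X]
  have hdet : ∀ (h : Draw K M n) j i,
      MvPolynomial.eval h (link X j i).det = (link h j i).det := fun h j i => by
    rw [← hlink h j i, ← AlgHom.map_det, MvPolynomial.aeval_eq_eval]
  have hword : ∀ h : Draw K M n,
      MvPolynomial.eval h (wordEntries (link X) u).det = (wordEntries (link h) u).det := by
    intro h
    have : wordEntries (link h) u = (MvPolynomial.aeval h).mapMatrix (wordEntries (link X) u) := by
      rw [mapMatrix_wordEntries]
      congr 1
      funext j i
      exact (hlink h j i).symm
    rw [this, ← AlgHom.map_det, MvPolynomial.aeval_eq_eval]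
  refine (eventually_all.2 fun j => eventually_all.2 fun i => ?_).and ?_
  · have hne : (link X j i).det ≠ 0 := fun h0 => by
      have h1 := hdet (fun c => if c.2.2.2.1 = c.2.2.2.2 then 1 else 0) j i
      rw [h0, link_identityDraw, map_zero, Matrix.det_one] at h1
      exact zero_ne_one h1
    filter_upwards [ae_eval_ne_zero μ hne] with h hh
    rwa [← hdet]
  · have hne : (wordEntries (link X) u).det ≠ 0 := fun h0 => by
      have h1 := hword (matrixUnitDraw u)
      rw [h0, wordEntries_matrixUnitDraw h02 h03 h12 h13 h23 h41 h42,
        map_zero, Matrix.det_one] at h1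
      exact zero_ne_one h1
    filter_upwards [ae_eval_ne_zero μ hne] with h hh
    rwa [← hword]

/-! ### Block diagonal matrices and their invariant subspaces -/

/-- The algebra of matrices that are block diagonal over the slots, encoded as the centralizer of
the coordinate projections onto the slots. -/
def slotAlgebra (M n : ℕ) : Subalgebra ℂ (Matrix (Fin M × Fin n) (Fin M × Fin n) ℂ) :=
  Subalgebra.centralizer ℂ
    (Set.range fun l : Fin n => Matrix.diagonal fun a => if a.2 = l then (1 : ℂ) else 0)

theorem mem_slotAlgebra_iff {A : Matrix (Fin M × Fin n) (Fin M × Fin n) ℂ} :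
    A ∈ slotAlgebra M n ↔ ∀ a b, a.2 ≠ b.2 → A a b = 0 := by
  simp only [slotAlgebra, Subalgebra.mem_centralizer_iff, Set.forall_mem_range, ← Matrix.ext_iff,
    Matrix.mul_diagonal, Matrix.diagonal_mul]
  constructor
  · intro h a b hab
    simpa [hab.symm] using h a.2 a b
  · intro h l a b
    by_cases hab : a.2 = b.2
    · simp [hab]
    · simp [h a b hab]

theorem link_mem_slotAlgebra (h : Draw K M n) (j i : Fin K) : link h j i ∈ slotAlgebra M n :=
  mem_slotAlgebra_iff.2 fun _ _ hab => Matrix.blockDiagonal_apply_ne _ _ _ hab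

theorem adjugate_mem_slotAlgebra {A : Matrix (Fin M × Fin n) (Fin M × Fin n) ℂ}
    (hA : A ∈ slotAlgebra M n) (hdet : A.det ≠ 0) : A.adjugate ∈ slotAlgebra M n := by
  rw [slotAlgebra, Subalgebra.mem_centralizer_iff] at hA ⊢
  intro P hP
  -- `A.det • (P * adj A)` and `A.det • (adj A * P)` both equal `adj A * (A * P) * adj A`
  refine smul_right_injective _ hdet ?_
  calc A.det • (P * A.adjugate) = (A.det • 1) * P * A.adjugate := by simp
    _ = A.adjugate * (A * P) * A.adjugate := by rw [← Matrix.adjugate_mul]; simp only [mul_assoc]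
    _ = A.adjugate * P * (A * A.adjugate) := by rw [← hA P hP]; simp only [mul_assoc]
    _ = A.det • (A.adjugate * P) := by rw [Matrix.mul_adjugate]; simp

/-- The algebra of matrices that map the subspace `W` into itself. -/
def stabilizerAlgebra {ι : Type*} [Fintype ι] [DecidableEq ι] (W : Submodule ℂ (ι → ℂ)) :
    Subalgebra ℂ (Matrix ι ι ℂ) where
  carrier := {A | ∀ v ∈ W, A.mulVec v ∈ W}
  mul_mem' := fun {A B} hA hB v hv => by
    rw [← Matrix.mulVec_mulVec]
    exact hA _ (hB v hv)
  add_mem' := fun {A B} hA hB v hv => by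
    rw [Matrix.add_mulVec]
    exact W.add_mem (hA v hv) (hB v hv)
  algebraMap_mem' := fun c v hv => by
    rw [Algebra.algebraMap_eq_smul_one, Matrix.smul_mulVec, Matrix.one_mulVec]
    exact W.smul_mem c hv

theorem aeval_mem_subalgebra {A : Type*} [Ring A] [Algebra ℂ A] {S : Subalgebra ℂ A} {x : A}
    (hx : x ∈ S) (p : Polynomial ℂ) : Polynomial.aeval x p ∈ S :=
  Algebra.adjoin_le (Set.singleton_subset_iff.2 hx) (Polynomial.aeval_mem_adjoin_singleton ℂ x)

/-- The dimension of a subspace invariant under all block diagonal matrices is a multiple of `M`,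
because the subspace consists of all vectors supported on some set of slots. -/
theorem finrank_of_slotAlgebra_le {W : Submodule ℂ (Fin M × Fin n → ℂ)}
    (hW : slotAlgebra M n ≤ stabilizerAlgebra W) : ∃ s : ℕ, Module.finrank ℂ W = M * s := by
  classical
  let S : Finset (Fin n) := Finset.univ.filter fun l => ∃ v ∈ W, ∃ r, v (r, l) ≠ 0
  refine ⟨S.card, ?_⟩
  let b : Fin M × S → (Fin M × Fin n → ℂ) := fun a => Pi.single (a.1, a.2.1) 1
  have hspan : Submodule.span ℂ (Set.range b) = W := by
    apply le_antisymm
    · rw [Submodule.span_le]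
      rintro _ ⟨⟨t, l, hl⟩, rfl⟩
      obtain ⟨v, hv, r, hr⟩ := (Finset.mem_filter.1 hl).2
      -- the matrix unit with row `(t, l)` and column `(r, l)` extracts the coordinate `v (r, l)`
      have := W.smul_mem (v (r, l))⁻¹ (hW (x := Matrix.single (t, l) (r, l) 1)
        (mem_slotAlgebra_iff.2 fun x y hxy => by
          rw [Matrix.single_apply, if_neg]
          rintro ⟨rfl, rfl⟩
          exact hxy rfl) v hv)
      rw [Matrix.single_mulVec] at this
      have hb : b (t, ⟨l, hl⟩) = (v (r, l))⁻¹ •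
          Function.update (0 : Fin M × Fin n → ℂ) (t, l) (1 * v (r, l)) := by
        ext x
        by_cases hx : x = (t, l)
        · subst hx
          simp [b, hr]
        · simp [b, hx]
      exact hb ▸ this
    · intro v hv
      rw [pi_eq_sum_univ' v]
      refine Submodule.sum_mem _ fun x _ => ?_
      by_cases hx : v x = 0
      · simp [hx]
      · refine Submodule.smul_mem _ _ (Submodule.subset_span ?_)
        refine ⟨(x.1, ⟨x.2, Finset.mem_filter.2 ⟨Finset.mem_univ _, v, hv, x.1, hx⟩⟩), ?_⟩
        ext y
        simp [b, Pi.single_apply]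
  have hli : LinearIndependent ℂ b := by
    refine (Pi.linearIndependent_single_one (Fin M × Fin n) ℂ).comp
      (fun a : Fin M × S => (a.1, a.2.1)) ?_
    rintro ⟨r, l⟩ ⟨r', l'⟩ h
    simp only [Prod.mk.injEq] at h
    exact Prod.ext h.1 (Subtype.ext h.2)
  rw [← hspan, finrank_span_eq_card hli]
  simp

/-! ### Aligned families of subspaces -/

/-- The signal spaces `W` of the users are aligned at the receivers `u 1`, ..., `u 4`, in as far
as transmitters `u 0`, ..., `u 3` are concerned. -/
structure LoopAligned {ι U : Type*} [Fintype ι] (H : U → U → Matrix ι ι ℂ) (u : Fin 5 → U)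
    (W : U → Submodule ℂ (ι → ℂ)) : Prop where
  at_one : (W (u 0)).map (H (u 1) (u 0)).mulVecLin = (W (u 2)).map (H (u 1) (u 2)).mulVecLin
  at_two : (W (u 0)).map (H (u 2) (u 0)).mulVecLin = (W (u 1)).map (H (u 2) (u 1)).mulVecLin
  at_two' : (W (u 0)).map (H (u 2) (u 0)).mulVecLin = (W (u 3)).map (H (u 2) (u 3)).mulVecLin
  at_three : (W (u 1)).map (H (u 3) (u 1)).mulVecLin = (W (u 2)).map (H (u 3) (u 2)).mulVecLin
  at_four : (W (u 2)).map (H (u 4) (u 2)).mulVecLin = (W (u 3)).map (H (u 4) (u 3)).mulVecLin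

/-- Alignment of `i` and `j` at receiver `k` is all that is needed here; the channels need not be
invertible, since the adjugate is used in place of the inverse. -/
theorem transfer_mulVec_mem {ι U : Type*} [Fintype ι] [DecidableEq ι] {H : U → U → Matrix ι ι ℂ}
    {W : U → Submodule ℂ (ι → ℂ)} {k i j : U}
    (h : (W i).map (H k i).mulVecLin = (W j).map (H k j).mulVecLin) {v : ι → ℂ} (hv : v ∈ W i) :
    (transfer H k i j).mulVec v ∈ W j := by
  obtain ⟨w, hw, hwv⟩ := h.le (Submodule.mem_map_of_mem hv)
  simp only [Matrix.mulVecLin_apply] at hwv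
  rw [transfer, ← Matrix.mulVec_mulVec, ← hwv, Matrix.mulVec_mulVec, Matrix.adjugate_mul,
    Matrix.smul_mulVec, Matrix.one_mulVec]
  exact (W j).smul_mem _ hw

theorem LoopAligned.innerLoop_mem {ι U : Type*} [Fintype ι] [DecidableEq ι]
    {H : U → U → Matrix ι ι ℂ} {u : Fin 5 → U} {W : U → Submodule ℂ (ι → ℂ)}
    (hW : LoopAligned H u W) : innerLoop H u ∈ stabilizerAlgebra (W (u 0)) := by
  intro v hv
  simp only [innerLoop, ← Matrix.mulVec_mulVec]
  exact transfer_mulVec_mem hW.at_one.symm (transfer_mulVec_mem hW.at_three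
    (transfer_mulVec_mem hW.at_two hv))

theorem LoopAligned.outerLoop_mem {ι U : Type*} [Fintype ι] [DecidableEq ι]
    {H : U → U → Matrix ι ι ℂ} {u : Fin 5 → U} {W : U → Submodule ℂ (ι → ℂ)}
    (hW : LoopAligned H u W) : outerLoop H u ∈ stabilizerAlgebra (W (u 0)) := by
  intro v hv
  simp only [outerLoop, ← Matrix.mulVec_mulVec]
  exact transfer_mulVec_mem hW.at_two'.symm (transfer_mulVec_mem hW.at_four
    (transfer_mulVec_mem hW.at_three (transfer_mulVec_mem hW.at_two hv)))

section Deterministic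

variable {h : Draw K M n} {u : Fin 5 → Fin K}

theorem loopWord_mem_slotAlgebra (hdet : ∀ j i, (link h j i).det ≠ 0)
    (c : Fin M × Fin M × Fin n) : loopWord (link h) u c ∈ slotAlgebra M n := by
  have ht : ∀ k i j, transfer (link h) k i j ∈ slotAlgebra M n := fun k i j =>
    mul_mem (adjugate_mem_slotAlgebra (link_mem_slotAlgebra h k j) (hdet k j))
      (link_mem_slotAlgebra h k i)
  have hF : innerLoop (link h) u ∈ slotAlgebra M n :=
    mul_mem (ht _ _ _) (mul_mem (ht _ _ _) (ht _ _ _))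
  have hG : outerLoop (link h) u ∈ slotAlgebra M n :=
    mul_mem (ht _ _ _) (mul_mem (ht _ _ _) (mul_mem (ht _ _ _) (ht _ _ _)))
  exact mul_mem (mul_mem (aeval_mem_subalgebra hF _) hG) (aeval_mem_subalgebra hF _)

/-- If the words in the two loops are linearly independent, they span all block diagonal matrices,
so that a signal space preserved by both loops is preserved by every block diagonal matrix. -/
theorem LoopAligned.slotAlgebra_le {W : Fin K → Submodule ℂ (Fin M × Fin n → ℂ)}
    (hdet : ∀ j i, (link h j i).det ≠ 0) (hE : (wordEntries (link h) u).det ≠ 0)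
    (hW : LoopAligned (link h) u W) : slotAlgebra M n ≤ stabilizerAlgebra (W (u 0)) := by
  intro A hA
  set x : Fin M × Fin M × Fin n → ℂ := (wordEntries (link h) u)⁻¹.mulVec
    fun c => A (c.1, c.2.2) (c.2.1, c.2.2)
  have hx : (wordEntries (link h) u).mulVec x = fun c => A (c.1, c.2.2) (c.2.1, c.2.2) := by
    rw [Matrix.mulVec_mulVec, Matrix.mul_nonsing_inv _ (isUnit_iff_ne_zero.2 hE),
      Matrix.one_mulVec]
  have hsum : A = ∑ c, x c • loopWord (link h) u c := by
    ext ⟨r, l⟩ ⟨t, l'⟩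
    by_cases hl : l = l'
    · subst hl
      have := congrFun hx (r, t, l)
      simp only [Matrix.mulVec, dotProduct, wordEntries, Matrix.of_apply] at this
      rw [← this, Matrix.sum_apply]
      exact Finset.sum_congr rfl fun c _ => by rw [Matrix.smul_apply, smul_eq_mul, mul_comm]
    · rw [mem_slotAlgebra_iff.1 hA _ _ hl, Matrix.sum_apply]
      refine (Finset.sum_eq_zero fun c _ => ?_).symm
      rw [Matrix.smul_apply, mem_slotAlgebra_iff.1 (loopWord_mem_slotAlgebra hdet c) _ _ hl,
        smul_zero]
  rw [hsum]
  exact sum_mem fun c _ => Subalgebra.smul_mem _ (mul_mem (mul_mem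
    (aeval_mem_subalgebra hW.innerLoop_mem _) hW.outerLoop_mem)
    (aeval_mem_subalgebra hW.innerLoop_mem _)) _

/-- The adjugate of an invertible matrix undoes it up to a nonzero factor. -/
theorem eq_inv_det_smul_adjugate_mulVec {ι : Type*} [Fintype ι] [DecidableEq ι]
    {A : Matrix ι ι ℂ} (hA : A.det ≠ 0) (v : ι → ℂ) :
    v = A.det⁻¹ • A.adjugate.mulVec (A.mulVec v) := by
  rw [Matrix.mulVec_mulVec, Matrix.adjugate_mul, Matrix.smul_mulVec, Matrix.one_mulVec,
    inv_smul_smul₀ hA]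

/-- At receiver `u 1` the desired signal lies inside the interference from `u 0`: since both
signal spaces are supported on the same set of slots, no link can move one out of the other. -/
theorem LoopAligned.map_le_map {W : Fin K → Submodule ℂ (Fin M × Fin n → ℂ)}
    (hdet : ∀ j i, (link h j i).det ≠ 0) (hE : (wordEntries (link h) u).det ≠ 0)
    (hW : LoopAligned (link h) u W) :
    (W (u 1)).map (link h (u 1) (u 1)).mulVecLin ≤
      (W (u 0)).map (link h (u 1) (u 0)).mulVecLin := by
  have hinv := hW.slotAlgebra_le hdet hE
  have hl := link_mem_slotAlgebra h
  have hadj : ∀ j i, (link h j i).adjugate ∈ slotAlgebra M n := fun j i =>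
    adjugate_mem_slotAlgebra (hl j i) (hdet j i)
  have h10 : W (u 1) ≤ W (u 0) := fun v hv => by
    obtain ⟨w, hw, hwv⟩ := hW.at_two.ge (Submodule.mem_map_of_mem hv)
    simp only [Matrix.mulVecLin_apply] at hwv
    rw [eq_inv_det_smul_adjugate_mulVec (hdet (u 2) (u 1)) v, ← hwv]
    exact Submodule.smul_mem _ _ (hinv (hadj _ _) _ (hinv (hl _ _) _ hw))
  rintro _ ⟨v, hv, rfl⟩
  refine ⟨(link h (u 1) (u 0)).det⁻¹ • (link h (u 1) (u 0)).adjugate.mulVec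
    ((link h (u 1) (u 1)).mulVec v), Submodule.smul_mem _ _ (hinv (hadj _ _) _
      (hinv (hl _ _) _ (h10 hv))), ?_⟩
  rw [Matrix.mulVecLin_apply, Matrix.mulVecLin_apply, Matrix.mulVec_smul, Matrix.mulVec_mulVec,
    Matrix.mul_adjugate, Matrix.smul_mulVec, Matrix.one_mulVec, inv_smul_smul₀ (hdet _ _)]

theorem finrank_map_mulVecLin {ι : Type*} [Fintype ι] [DecidableEq ι] {A : Matrix ι ι ℂ}
    (hA : A.det ≠ 0) (W : Submodule ℂ (ι → ℂ)) :
    Module.finrank ℂ (W.map A.mulVecLin) = Module.finrank ℂ W := by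
  refine (Submodule.equivMapOfInjective _ (fun v w hvw => ?_) W).finrank_eq.symm
  rw [eq_inv_det_smul_adjugate_mulVec hA v, eq_inv_det_smul_adjugate_mulVec hA w]
  exact congrArg (fun x => A.det⁻¹ • A.adjugate.mulVec x) hvw

end Deterministic

/-! ### The cyclic network -/

theorem interferes_add [NeZero K] {N m : ℕ} (hm : 1 ≤ m) (hmN : m ≤ (N + 1) / 2) (i : Fin K) :
    Interferes K N (i + Fin.ofNat K m) i :=
  Or.inl ⟨m, hm, hmN, by simp [Fin.val_add]⟩

theorem interferes_ofNat_add [NeZero K] {N m : ℕ} (hm : 1 ≤ m) (hmN : m ≤ (N + 1) / 2) (a : ℕ) :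
    Interferes K N (Fin.ofNat K (a + m)) (Fin.ofNat K a) :=
  Or.inl ⟨m, hm, hmN, by simp⟩

theorem interferes_ofNat_succ [NeZero K] {N : ℕ} (hN : 1 ≤ N / 2) (a : ℕ) :
    Interferes K N (Fin.ofNat K a) (Fin.ofNat K (a + 1)) :=
  Or.inr ⟨1, le_rfl, hN, by simp⟩

theorem Interferes.ne {N : ℕ} (hK : N + 1 ≤ K) {j i : Fin K}
    (h : Interferes K N j i) : i ≠ j := by
  have key : ∀ a m : ℕ, a < K → 1 ≤ m → m < K → (a + m) % K ≠ a := fun a m ha h1 h2 h3 => by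
    rcases lt_or_ge (a + m) K with h4 | h4
    · rw [Nat.mod_eq_of_lt h4] at h3
      omega
    · rw [Nat.mod_eq_sub_mod h4, Nat.mod_eq_of_lt (by omega)] at h3
      omega
  rintro rfl
  rcases h with ⟨m, h1, h2, h3⟩ | ⟨m, h1, h2, h3⟩
  · exact key i m i.2 h1 (by omega) h3
  · exact key i m i.2 h1 (by omega) h3

theorem channel_of_interferes {N : ℕ} (h : Draw K M n) {j i : Fin K} (hji : Interferes K N j i) :
    channel N h j i = link h j i := by
  rw [channel, if_pos (Or.inr hji)]
  rfl

theorem channel_self (N : ℕ) (h : Draw K M n) (j : Fin K) : channel N h j j = link h j j := by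
  rw [channel, if_pos (Or.inl rfl)]
  rfl

/-- Five consecutive users; the last one is the first one again if there are only four. -/
def consecutiveUsers (K : ℕ) [NeZero K] (k : Fin 5) : Fin K := Fin.ofNat K k

theorem loopAligned_of_aligned [NeZero K] {N : ℕ} (hN : 3 ≤ N) {h : Draw K M n}
    {W : Fin K → Submodule ℂ (Fin M × Fin n → ℂ)}
    (hW : ∀ j i i' : Fin K, Interferes K N j i → Interferes K N j i' →
      (W i).map (channel N h j i).mulVecLin = (W i').map (channel N h j i').mulVecLin) :
    LoopAligned (link h) (consecutiveUsers K) W := by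
  have hW' : ∀ j i i' : Fin K, Interferes K N j i → Interferes K N j i' →
      (W i).map (link h j i).mulVecLin = (W i').map (link h j i').mulVecLin :=
    fun j i i' hi hi' => by
      rw [← channel_of_interferes h hi, ← channel_of_interferes h hi']
      exact hW j i i' hi hi'
  have h1 := interferes_ofNat_add (K := K) (N := N) (m := 1) le_rfl (by omega)
  have h2 := interferes_ofNat_add (K := K) (N := N) (m := 2) (by omega) (by omega)
  have h3 := interferes_ofNat_succ (K := K) (N := N) (by omega)
  exact ⟨hW' _ _ _ (h1 0) (h3 1), hW' _ _ _ (h2 0) (h1 1), hW' _ _ _ (h2 0) (h3 2),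
    hW' _ _ _ (h2 1) (h1 2), hW' _ _ _ (h2 2) (h1 3)⟩

/-! ### Counting dimensions -/

/-- If the users `j` have `s j` interference-free dimensions out of `D`, signal spaces of dimension
`d j` and interference spaces of dimension `q j`, then a sum of `K D / 2` interference-free
dimensions leaves no slack: adding `s (j + 1) + s j ≤ D` and `s (j + 2) + s j ≤ D` around the cycle
gives equality everywhere, so that `s` is constant. -/
theorem eq_half_of_le_sum [NeZero K] {N D : ℕ} (hN : 3 ≤ N) {s d q : Fin K → ℕ}
    (hsq : ∀ j, s j + q j ≤ D) (hsd : ∀ j, s j ≤ d j)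
    (hdq : ∀ j i, Interferes K N j i → d i ≤ q j) (hsum : K * D ≤ 2 * ∑ j, s j) (j : Fin K) :
    2 * s j = D ∧ 2 * d j = D ∧ 2 * q j = D := by
  have hshift : ∀ m, 1 ≤ m → m ≤ 2 → ∀ i, s (i + Fin.ofNat K m) + s i = D := by
    intro m h1 h2
    have hle : ∀ i ∈ Finset.univ, s (i + Fin.ofNat K m) + s i ≤ D := fun i _ => by
      have := hdq _ i (interferes_add h1 (by omega) i)
      have := hsq (i + Fin.ofNat K m)
      have := hsd i
      omega
    have heq : ∑ i, (s (i + Fin.ofNat K m) + s i) = ∑ _i : Fin K, D := by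
      refine le_antisymm (Finset.sum_le_sum hle) ?_
      have : ∑ i, s (i + Fin.ofNat K m) = ∑ i, s i :=
        Equiv.sum_comp (Equiv.addRight (Fin.ofNat K m)) s
      rw [Finset.sum_add_distrib, this, Finset.sum_const, Finset.card_univ, Fintype.card_fin,
        smul_eq_mul]
      omega
    exact fun i => (Finset.sum_eq_sum_iff_of_le hle).1 heq i (Finset.mem_univ i)
  have hs : ∀ i, 2 * s i = D := fun i => by
    have h1 := hshift 1 le_rfl (by omega) (i - Fin.ofNat K 1)
    have h2 := hshift 2 (by omega) le_rfl (i - Fin.ofNat K 1)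
    have h3 := hshift 1 le_rfl (by omega) i
    have h4 : i - Fin.ofNat K 1 + Fin.ofNat K 2 = i + Fin.ofNat K 1 := by
      have : (Fin.ofNat K 2 : Fin K) = Fin.ofNat K 1 + Fin.ofNat K 1 := by
        ext
        simp [Fin.val_add]
      rw [this]
      abel
    rw [sub_add_cancel] at h1
    rw [h4] at h2
    omega
  have hd : ∀ i, 2 * d i = D := fun i => by
    have := hdq _ i (interferes_add le_rfl (by omega) i)
    have := hsq (i + Fin.ofNat K 1)
    have := hs (i + Fin.ofNat K 1)
    have := hs i
    have := hsd i
    omega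
  refine ⟨hs j, hd j, ?_⟩
  have h1 := hdq j (j - Fin.ofNat K 1) (by
    simpa using interferes_add (N := N) le_rfl (by omega) (j - Fin.ofNat K 1))
  have := hd (j - Fin.ofNat K 1)
  have := hs j
  have := hsq j
  omega

theorem colSpace_mul {m p q : Type*} [Fintype p] [Fintype q] (A : Matrix m p ℂ)
    (B : Matrix p q ℂ) : colSpace (A * B) = (colSpace B).map A.mulVecLin := by
  rw [colSpace, Matrix.mulVecLin_mul, LinearMap.range_comp, colSpace]

/-! ### Infeasibility of alignment and the loss of multiplexing gain -/

section Generic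

variable [NeZero K] {N : ℕ} {h : Draw K M n}

/-- For generic channels, alignment puts the desired signal of some user into the interference, so
that the two can only be separated if that user does not send anything. -/
theorem eq_bot_of_aligned_of_disjoint (hN : 3 ≤ N)
    (hdet : ∀ j i, (link h j i).det ≠ 0)
    (hE : (wordEntries (link h) (consecutiveUsers K)).det ≠ 0)
    {W : Fin K → Submodule ℂ (Fin M × Fin n → ℂ)}
    (hW : ∀ j i i' : Fin K, Interferes K N j i → Interferes K N j i' →
      (W i).map (channel N h j i).mulVecLin = (W i').map (channel N h j i').mulVecLin)
    (hdisj : ∀ j, Disjoint ((W j).map (channel N h j j).mulVecLin)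
      (⨆ (i : Fin K) (_ : Interferes K N j i), (W i).map (channel N h j i).mulVecLin)) :
    W (consecutiveUsers K 1) = ⊥ := by
  have hI : Interferes K N (consecutiveUsers K 1) (consecutiveUsers K 0) :=
    interferes_ofNat_add (m := 1) le_rfl (by omega) 0
  have hle := (loopAligned_of_aligned hN hW).map_le_map hdet hE
  rw [← channel_of_interferes h hI, ← channel_self N h] at hle
  have hbot := (hdisj (consecutiveUsers K 1)).eq_bot_of_le
    (hle.trans (le_iSup₂_of_le (consecutiveUsers K 0) hI le_rfl))
  rw [channel_self] at hbot
  rw [← Submodule.finrank_eq_zero, ← finrank_map_mulVecLin (hdet _ _), hbot, finrank_bot]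

theorem not_aligned_and_separated (hN : 3 ≤ N) (hdet : ∀ j i, (link h j i).det ≠ 0)
    (hE : (wordEntries (link h) (consecutiveUsers K)).det ≠ 0) {d : ℕ} (hd : 0 < d)
    {V : Fin K → Matrix (Fin M × Fin n) (Fin d) ℂ} (hV : ∀ k, (V k).rank = d)
    (hA : Aligned N h V) : ¬ Separated N h V := by
  intro hS
  simp only [Aligned, Separated, colSpace_mul] at hA hS
  have hbot := eq_bot_of_aligned_of_disjoint hN hdet hE hA hS
  have hrank := hV (consecutiveUsers K 1)
  rw [Matrix.rank, show LinearMap.range (V (consecutiveUsers K 1)).mulVecLin = ⊥ from hbot,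
    finrank_bot] at hrank
  omega

theorem not_aligned_of_odd (hN : 3 ≤ N) (hM : 1 ≤ M) (hdet : ∀ j i, (link h j i).det ≠ 0)
    (hE : (wordEntries (link h) (consecutiveUsers K)).det ≠ 0) (hn : Odd n) {d : ℕ}
    (hd : 2 * d = M * n) {V : Fin K → Matrix (Fin M × Fin n) (Fin d) ℂ}
    (hV : ∀ k, (V k).rank = d) : ¬ Aligned N h V := by
  intro hA
  simp only [Aligned, colSpace_mul] at hA
  obtain ⟨s, hs⟩ := finrank_of_slotAlgebra_le
    ((loopAligned_of_aligned hN hA).slotAlgebra_le hdet hE)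
  have hrank : d = M * s := (hV (consecutiveUsers K 0)).symm.trans hs
  have : 2 * s = n := Nat.eq_of_mul_eq_mul_left hM (by rw [← hd, hrank]; ring)
  rcases hn with ⟨k, hk⟩
  omega

/-- For generic channels the interference-free dimensions of all receivers together are fewer than
`K M n / 2`: otherwise the signal spaces would be aligned and separated. -/
theorem sum_finrank_sub_lt (hN : 3 ≤ N) (hK : N + 1 ≤ K) (hM : 1 ≤ M) (hn : 1 ≤ n)
    (hdet : ∀ j i, (link h j i).det ≠ 0)
    (hE : (wordEntries (link h) (consecutiveUsers K)).det ≠ 0)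
    (W : Fin K → Submodule ℂ (Fin M × Fin n → ℂ)) :
    2 * ∑ j, (Module.finrank ℂ (⨆ i ∈ (Finset.univ : Finset (Fin K)),
          (W i).map (channel N h j i).mulVecLin : Submodule ℂ (Fin M × Fin n → ℂ)) -
        Module.finrank ℂ (⨆ i ∈ Finset.univ.erase j,
          (W i).map (channel N h j i).mulVecLin : Submodule ℂ (Fin M × Fin n → ℂ))) <
      K * (M * n) := by
  by_contra! hsum
  let S : Fin K → Submodule ℂ (Fin M × Fin n → ℂ) := fun j =>
    (W j).map (channel N h j j).mulVecLin
  let Q : Fin K → Submodule ℂ (Fin M × Fin n → ℂ) := fun j =>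
    ⨆ i ∈ Finset.univ.erase j, (W i).map (channel N h j i).mulVecLin
  have htot : ∀ j, (⨆ i ∈ (Finset.univ : Finset (Fin K)), (W i).map (channel N h j i).mulVecLin :
      Submodule ℂ (Fin M × Fin n → ℂ)) = S j ⊔ Q j := fun j => by
    rw [← Finset.insert_erase (Finset.mem_univ j), Finset.iSup_insert]
  replace hsum : K * (M * n) ≤
      2 * ∑ j, (Module.finrank ℂ ↥(S j ⊔ Q j) - Module.finrank ℂ (Q j)) :=
    hsum.trans_eq (congrArg _ (Finset.sum_congr rfl fun j _ => by rw [htot j]))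
  have hQS : ∀ j, Module.finrank ℂ (Q j) ≤ Module.finrank ℂ ↥(S j ⊔ Q j) := fun j =>
    Submodule.finrank_mono le_sup_right
  have hSW : ∀ j, Module.finrank ℂ (S j) = Module.finrank ℂ (W j) := fun j => by
    change Module.finrank ℂ ((W j).map (channel N h j j).mulVecLin) = _
    rw [channel_self]
    exact finrank_map_mulVecLin (hdet j j) _
  have hIW : ∀ j i, Interferes K N j i →
      Module.finrank ℂ ((W i).map (channel N h j i).mulVecLin) = Module.finrank ℂ (W i) :=
    fun j i hji => by
      rw [channel_of_interferes h hji]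
      exact finrank_map_mulVecLin (hdet j i) _
  have hIQ : ∀ j i, Interferes K N j i → (W i).map (channel N h j i).mulVecLin ≤ Q j :=
    fun j i hji => le_iSup₂_of_le i
      (Finset.mem_erase.2 ⟨hji.ne hK, Finset.mem_univ i⟩) le_rfl
  have hsup : ∀ j, Module.finrank ℂ ↥(S j ⊔ Q j) + Module.finrank ℂ ↥(S j ⊓ Q j) =
      Module.finrank ℂ (S j) + Module.finrank ℂ (Q j) := fun j =>
    Submodule.finrank_sup_add_finrank_inf_eq _ _
  have hsq : ∀ j, Module.finrank ℂ ↥(S j ⊔ Q j) - Module.finrank ℂ (Q j) +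
      Module.finrank ℂ (Q j) ≤ M * n := fun j => by
    rw [Nat.sub_add_cancel (hQS j)]
    simpa using Submodule.finrank_le (S j ⊔ Q j)
  have hsd : ∀ j, Module.finrank ℂ ↥(S j ⊔ Q j) - Module.finrank ℂ (Q j) ≤
      Module.finrank ℂ (W j) := fun j => by
    have := hsup j
    have := hSW j
    omega
  have hdq : ∀ j i, Interferes K N j i → Module.finrank ℂ (W i) ≤ Module.finrank ℂ (Q j) :=
    fun j i hji => by
      rw [← hIW j i hji]
      exact Submodule.finrank_mono (hIQ j i hji)
  have hhalf := eq_half_of_le_sum hN hsq hsd hdq hsum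
  have hfill : ∀ j i, Interferes K N j i → (W i).map (channel N h j i).mulVecLin = Q j :=
    fun j i hji => Submodule.eq_of_le_of_finrank_eq (hIQ j i hji) (by
      rw [hIW j i hji]
      have := (hhalf i).2.1
      have := (hhalf j).2.2
      omega)
  have hdisj : ∀ j, Disjoint (S j) (Q j) := fun j => by
    rw [disjoint_iff, ← Submodule.finrank_eq_zero (R := ℂ)]
    have := hsup j
    have := hSW j
    have := hQS j
    have := hhalf j
    omega
  have hbot := eq_bot_of_aligned_of_disjoint hN hdet hE
    (fun j i i' hi hi' => (hfill j i hi).trans (hfill j i' hi').symm)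
    (fun j => (hdisj j).mono_right (iSup₂_le fun i hi => hIQ j i hi))
  have h1 := (hhalf (consecutiveUsers K 1)).2.1
  rw [hbot, finrank_bot] at h1
  have := Nat.mul_pos hM hn
  omega

open scoped ComplexOrder in
theorem exists_multiplexingGain_lt (hN : 3 ≤ N) (hK : N + 1 ≤ K) (hM : 1 ≤ M) (hn : 1 ≤ n)
    (hdet : ∀ j i, (link h j i).det ≠ 0)
    (hE : (wordEntries (link h) (consecutiveUsers K)).det ≠ 0) {d : Fin K → ℕ}
    (V : (k : Fin K) → Matrix (Fin M × Fin n) (Fin (d k)) ℂ) :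
    ∃ Γ : ℝ, Γ < (K : ℝ) * (M : ℝ) / 2 ∧ HasMultiplexingGain N h V Γ := by
  set a : Fin K → ℕ := fun j => (∑ i, signalCov N h V j i).rank with ha
  set q : Fin K → ℕ := fun j => (∑ i ∈ Finset.univ.erase j, signalCov N h V j i).rank with hq
  have hrank : ∀ (j : Fin K) (s : Finset (Fin K)), (∑ i ∈ s, signalCov N h V j i).rank =
      Module.finrank ℂ (⨆ i ∈ s, (colSpace (V i)).map (channel N h j i).mulVecLin :
        Submodule ℂ (Fin M × Fin n → ℂ)) := fun j s => by
    rw [show (⨆ i ∈ s, (colSpace (V i)).map (channel N h j i).mulVecLin) =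
      ⨆ i ∈ s, colSpace (channel N h j i * V i) by simp only [colSpace_mul]]
    exact rank_sum_mul_conjTranspose s fun i => channel N h j i * V i
  have hlim : ∀ (j : Fin K) (s : Finset (Fin K)),
      Tendsto (fun ρ : ℝ => Real.log (1 + (ρ : ℂ) • ∑ i ∈ s, signalCov N h V j i).det.re /
        Real.log ρ) atTop (𝓝 ((∑ i ∈ s, signalCov N h V j i).rank : ℝ)) := fun j s =>
    tendsto_log_det_div_log (Matrix.posSemidef_sum s fun i _ =>
      Matrix.posSemidef_self_mul_conjTranspose _)
  have hqa : ∀ j, q j ≤ a j := fun j => by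
    simp only [ha, hq, hrank]
    exact Submodule.finrank_mono (biSup_mono fun i _ => Finset.mem_univ i)
  have hn0 : (0 : ℝ) < n := by exact_mod_cast hn
  refine ⟨(∑ j, ((a j : ℝ) - q j)) / n, ?_, ?_⟩
  · have hlt := sum_finrank_sub_lt hN hK hM hn hdet hE fun i => colSpace (V i)
    simp only [← hrank] at hlt
    have hlt' : (2 : ℝ) * ∑ j, ((a j : ℝ) - q j) < K * (M * n) := by
      have hcast : ∑ j, ((a j : ℝ) - q j) = ((∑ j, (a j - q j) : ℕ) : ℝ) := by
        rw [Nat.cast_sum]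
        exact Finset.sum_congr rfl fun j _ => (Nat.cast_sub (hqa j)).symm
      rw [hcast]
      exact_mod_cast hlt
    rw [div_lt_div_iff₀ hn0 two_pos]
    linarith
  · have := (tendsto_finsetSum Finset.univ fun j (_ : j ∈ Finset.univ) =>
      (hlim j Finset.univ).sub (hlim j (Finset.univ.erase j))).div_const (n : ℝ)
    refine this.congr fun ρ => ?_
    rw [sumRate, div_right_comm, Finset.sum_div _ _ (Real.log ρ)]
    simp only [sub_div]

end Generic

theorem consecutiveUsers_ne [NeZero K] {k l : Fin 5}
    (hk : (k : ℕ) % K ≠ (l : ℕ) % K) :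
    consecutiveUsers K k ≠ consecutiveUsers K l := fun h => hk (congrArg Fin.val h)

end PartialIC

theorem theorem4 (K N M n : ℕ) (hN : 3 ≤ N) (hK : N + 1 ≤ K) (hM : 1 ≤ M) (hn : 1 ≤ n)
    (μ : MeasureTheory.Measure ℂ) [MeasureTheory.IsProbabilityMeasure μ]
    [MeasureTheory.NullSingletonClass μ] :
    ∀ᵐ h ∂(PartialIC.drawLaw K M n μ),
      (∀ d : ℕ, 2 * d = M * n →
        ¬ ∃ V : Fin K → Matrix (Fin M × Fin n) (Fin d) ℂ,
          (∀ k, (V k).rank = d) ∧ PartialIC.Aligned N h V ∧ PartialIC.Separated N h V) ∧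
      (Odd n → ∀ d : ℕ, 2 * d = M * n →
        ¬ ∃ V : Fin K → Matrix (Fin M × Fin n) (Fin d) ℂ,
          (∀ k, (V k).rank = d) ∧ PartialIC.Aligned N h V) ∧
      (∀ (d : Fin K → ℕ) (V : (k : Fin K) → Matrix (Fin M × Fin n) (Fin (d k)) ℂ),
        ∃ Γ : ℝ, Γ < (K : ℝ) * (M : ℝ) / 2 ∧ PartialIC.HasMultiplexingGain N h V Γ) := by
  have : NeZero K := ⟨by omega⟩
  have h4 : ∀ k : ℕ, k < 4 → k % K = k := fun k hk => Nat.mod_eq_of_lt (by omega)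
  -- with exactly four users, user `4` is user `0`
  have h4K : 4 % K ≠ 1 ∧ 4 % K ≠ 2 := by
    rcases (show K = 4 ∨ 4 < K by omega) with rfl | hK4
    · simp
    · rw [Nat.mod_eq_of_lt hK4]
      simp
  have hgen := PartialIC.ae_generic (K := K) (M := M) (n := n) μ
    (u := PartialIC.consecutiveUsers K)
    (PartialIC.consecutiveUsers_ne (by simp [h4])) (PartialIC.consecutiveUsers_ne (by simp [h4]))
    (PartialIC.consecutiveUsers_ne (by simp [h4])) (PartialIC.consecutiveUsers_ne (by simp [h4]))
    (PartialIC.consecutiveUsers_ne (by simp [h4]))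
    (PartialIC.consecutiveUsers_ne (by simpa [h4] using h4K.1))
    (PartialIC.consecutiveUsers_ne (by simpa [h4] using h4K.2))
  filter_upwards [hgen] with h hh
  refine ⟨fun d hd => ?_, fun hodd d hd => ?_, fun d V => ?_⟩
  · rintro ⟨V, hV, hA, hS⟩
    have := Nat.mul_pos hM hn
    exact PartialIC.not_aligned_and_separated hN hh.1 hh.2 (by omega) hV hA hS
  · rintro ⟨V, hV, hA⟩
    exact PartialIC.not_aligned_of_odd hN hM hh.1 hh.2 hodd hd hV hA
  · exact PartialIC.exists_multiplexingGain_lt hN hK hM hn hh.1 hh.2 V
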